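/- Let $\mathbb{D}^2$ be the open unit bidisk and let $H^2(\mathbb{D}^2)$ be the Hardy space of holomorphic functions $f$ on $\mathbb{D}^2$ with $\|f\|^2=\sup_{0\le r<1}\int_{\mathbb{T}^2}|f(rz,rw)|^2\,dm<\infty$, where $dm$ is normalized Lebesgue measure on $\mathbb{T}^2$. For $p\in\mathbb{C}[z,w]$ let $[p]$ be the submodule of $H^2(\mathbb{D}^2)$ generated by $p$ (the closure of $p\,\mathbb{C}[z,w]$), let $\mathcal{N}=[p]^\perp=H^2(\mathbb{D}^2)\ominus[p]$, and let $S_z=P_{\mathcal{N}}T_z|_{\mathcal{N}}$ be the compression to $\mathcal{N}$ of the operator $T_z$ of multiplication by $z$. Say that $p$ has the divisor property if every $f\in H^2(\mathbb{D}^2)$ for which $f/p$ is holomorphic in $\mathbb{D}^2$ belongs to $[p]$. A bounded operator $T$ on a Hilbert space is reducible if it has a closed subspace, different from $\{0\}$ and from the whole space, that is invariant under $T$ and $T^*$; and $V^*(T)=\{T,T^*\}'$ denotes the von Neumann algebra of bounded operators commuting with $T$ and $T^*$. Suppose $p\in\mathbb{C}[z,w]$ has a zero in $\mathbb{D}^2$,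 has no nonconstant factor depending only on $z$, and has the divisor property. If $p(z,w)=q(z,w^n)$ for some polynomial $q\in\mathbb{C}[z,w]$ and some integer $n\ge 2$, then $S_z$ on $\mathcal{N}=[p]^\perp$ is reducible, and $\dim_{\mathbb{C}} V^*(S_z)\ge n^2$. -/

import Mathlib

namespace BidiskHardy

open Complex MeasureTheory Metric

/-- The open unit bidisk. -/
def bidisk : Set (ℂ × ℂ) := ball 0 1 ×ˢ ball 0 1

/-- The normalized mean over the torus `|z| = |w| = r` of `|f(z, w)|²`. -/
noncomputable def torusMean (f : ℂ × ℂ → ℂ) (r : ℝ) : ℝ :=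
  Real.circleAverage (fun z => Real.circleAverage (fun w => ‖f (z, w)‖ ^ 2) 0 r) 0 r

/-! ### Fourier analysis on tori inside the bidisk -/

noncomputable section Fourier

/-- Normalized Haar measure on the circle `ℝ / ℤ`. -/
local instance circleMeasureSpace : MeasureSpace UnitAddCircle := ⟨AddCircle.haarAddCircle⟩

local instance circleIsAddHaar : Measure.IsAddHaarMeasure (volume : Measure UnitAddCircle) :=
  inferInstanceAs (Measure.IsAddHaarMeasure AddCircle.haarAddCircle)

local instance circleIsProb : IsProbabilityMeasure (volume : Measure UnitAddCircle) :=
  inferInstanceAs (IsProbabilityMeasure AddCircle.haarAddCircle)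

lemma circle_integral_eq {E : Type*} [NormedAddCommGroup E] [NormedSpace ℝ E] (g : ℂ → E) (r : ℝ) :
    ∫ x : UnitAddCircle, g ((r : ℂ) * fourier 1 x) = Real.circleAverage g 0 r := by
  have h1 : (volume : Measure UnitAddCircle) = (AddCircle.measureSpace 1).volume := by
    rw [AddCircle.volume_eq_smul_haarAddCircle]
    simp; rfl
  rw [h1]
  have h2 := UnitAddCircle.intervalIntegral_preimage 0 (fun x => g ((r : ℂ) * fourier 1 x))
  refine h2.symm.trans ?_
  rw [Real.circleAverage_def]
  have h3 := intervalIntegral.integral_comp_mul_left (a := 0) (b := 1)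
    (fun θ => g (circleMap 0 r θ)) (c := 2 * Real.pi) (by positivity)
  simp only [mul_zero, mul_one] at h3
  rw [← h3, zero_add]
  refine intervalIntegral.integral_congr fun x _ => ?_
  simp only [fourier_coe_apply, circleMap]
  congr 3
  push_cast
  rw [zero_add]
  congr 2
  ring

/-- The point of the torus `|z| = r`, `|w| = s` with angles `x 0`, `x 1`. -/
def torusPt (r s : ℝ) (x : UnitAddTorus (Fin 2)) : ℂ × ℂ :=
  ((r : ℂ) * fourier 1 (x 0), (s : ℂ) * fourier 1 (x 1))

lemma norm_fourier_apply (n : ℤ) (x : UnitAddCircle) : ‖fourier n x‖ = 1 := by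
  rw [fourier_apply]; exact Circle.norm_coe _

lemma continuous_torusPt (r s : ℝ) : Continuous (torusPt r s) := by
  unfold torusPt; fun_prop

lemma pt_mem {r s : ℝ} (hr : r ∈ Set.Ico (0 : ℝ) 1) (hs : s ∈ Set.Ico (0 : ℝ) 1)
    (x y : UnitAddCircle) :
    ((r : ℂ) * fourier 1 x, (s : ℂ) * fourier 1 y) ∈ bidisk := by
  have h (r : ℝ) (hr : r ∈ Set.Ico (0 : ℝ) 1) (x : UnitAddCircle) :
      (r : ℂ) * fourier 1 x ∈ ball (0 : ℂ) 1 := by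
    rw [mem_ball_zero_iff, norm_mul, norm_fourier_apply, mul_one, norm_real, Real.norm_eq_abs,
      abs_of_nonneg hr.1]
    exact hr.2
  exact ⟨h r hr x, h s hs y⟩

lemma torus_integral_eq {E : Type*} [NormedAddCommGroup E] [NormedSpace ℝ E]
    (G : UnitAddCircle → UnitAddCircle → E) (hG : Continuous fun x : UnitAddCircle × UnitAddCircle => G x.1 x.2) :
    ∫ x : UnitAddTorus (Fin 2), G (x 0) (x 1) = ∫ a, ∫ b, G a b := by
  have h := (volume_preserving_finTwoArrow UnitAddCircle).integral_comp
    (MeasurableEquiv.finTwoArrow.measurableEmbedding) (fun x => G x.1 x.2)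
  refine h.trans ?_
  refine integral_prod (fun x : UnitAddCircle × UnitAddCircle => G x.1 x.2) ?_
  exact (hG.integrable_of_hasCompactSupport (HasCompactSupport.of_compactSpace _))

lemma integral_fourier (m : ℤ) : ∫ x : UnitAddCircle, fourier m x = if m = 0 then 1 else 0 := by
  have h := (orthonormal_iff_ite.1 (orthonormal_fourier (T := (1 : ℝ)))) 0 m
  rw [ContinuousMap.inner_toLp] at h
  simp only [fourier_zero, map_one, mul_one] at h
  refine Eq.trans h ?_
  simp only [eq_comm]

lemma fourier_pow (x : UnitAddCircle) (n : ℕ) : fourier (n : ℤ) x = fourier 1 x ^ n := by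
  induction n with
  | zero => simp
  | succ n ih => rw [Nat.cast_succ, fourier_add, ih, pow_succ]

lemma circle_coeff {h : ℂ → ℂ} (hh : DifferentiableOn ℂ h (ball 0 1)) {r : ℝ}
    (hr : r ∈ Set.Ico (0 : ℝ) 1) (k : ℤ) :
    ∫ x : UnitAddCircle, fourier (-k) x * h ((r : ℂ) * fourier 1 x) =
      if 0 ≤ k then (r : ℂ) ^ k.toNat * ((k.toNat.factorial : ℂ)⁻¹ * iteratedDeriv k.toNat h 0)
      else 0 := by
  set b : ℕ → ℂ := fun n => (n.factorial : ℂ)⁻¹ * iteratedDeriv n h 0 with hb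
  have hr1 : (r : ℂ) ∈ ball (0 : ℂ) 1 := by
    simpa [abs_of_nonneg hr.1] using hr.2
  have hser : ∀ z ∈ ball (0 : ℂ) 1, HasSum (fun n => b n * z ^ n) (h z) := by
    intro z hz
    have := Complex.hasSum_taylorSeries_on_ball hh hz
    convert! this using 2 with n
    simp only [hb, sub_zero, smul_eq_mul]
    ring
  have hsum : Summable fun n => ‖b n * (r : ℂ) ^ n‖ := (hser r hr1).summable.norm
  have hF : ∀ x : UnitAddCircle, HasSum (fun n : ℕ => (b n * (r : ℂ) ^ n) * fourier ((n : ℤ) - k) x)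
      (fourier (-k) x * h ((r : ℂ) * fourier 1 x)) := by
    intro x
    have := (hser _ (pt_mem hr hr x x).1).mul_left (fourier (-k) x)
    convert! this using 2 with n
    rw [sub_eq_add_neg, fourier_add, fourier_pow]
    ring
  have hint := hasSum_integral_of_summable_integral_norm (μ := (volume : Measure UnitAddCircle))
    (F := fun (n : ℕ) x => (b n * (r : ℂ) ^ n) * fourier ((n : ℤ) - k) x) (fun n => by
      apply Continuous.integrable_of_hasCompactSupport (by fun_prop)
        (HasCompactSupport.of_compactSpace _)) (by
      simpa only [norm_mul (b _ * _), norm_fourier_apply, mul_one, integral_const,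
        probReal_univ, one_smul] using hsum)
  have e1 : (∫ x : UnitAddCircle, ∑' n : ℕ, (b n * (r : ℂ) ^ n) * fourier ((n : ℤ) - k) x) =
      ∫ x : UnitAddCircle, fourier (-k) x * h ((r : ℂ) * fourier 1 x) :=
    integral_congr_ae (.of_forall fun x => (hF x).tsum_eq)
  rw [e1] at hint
  refine hint.unique ?_
  simp only [integral_const_mul, integral_fourier]
  split_ifs with hk
  · convert! hasSum_ite_eq k.toNat ((r : ℂ) ^ k.toNat * b k.toNat) using 2 with n
    by_cases hn : n = k.toNat
    · subst hn
      simp [hk, mul_comm]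
    · rw [if_neg (by omega), if_neg hn, mul_zero]
  · convert! hasSum_zero using 2 with n
    rw [if_neg (by omega), mul_zero]

/-- Fourier coefficients of `f` restricted to the torus `|z| = r`, `|w| = s`. -/
def torusCoeff (f : ℂ × ℂ → ℂ) (r s : ℝ) (j k : ℤ) : ℂ :=
  UnitAddTorus.mFourierCoeff (fun x => f (torusPt r s x)) ![j, k]

lemma continuous_pt {f : ℂ × ℂ → ℂ} (hf : ContinuousOn f bidisk) {r s : ℝ}
    (hr : r ∈ Set.Ico (0 : ℝ) 1) (hs : s ∈ Set.Ico (0 : ℝ) 1) :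
    Continuous fun x : UnitAddCircle × UnitAddCircle =>
      f ((r : ℂ) * fourier 1 x.1, (s : ℂ) * fourier 1 x.2) :=
  hf.comp_continuous (by fun_prop) fun x => pt_mem hr hs x.1 x.2

lemma torusCoeff_eq {f : ℂ × ℂ → ℂ} (hf : ContinuousOn f bidisk) {r s : ℝ}
    (hr : r ∈ Set.Ico (0 : ℝ) 1) (hs : s ∈ Set.Ico (0 : ℝ) 1) (j k : ℤ) :
    torusCoeff f r s j k = ∫ a : UnitAddCircle, fourier (-j) a *
      ∫ b : UnitAddCircle, fourier (-k) b * f ((r : ℂ) * fourier 1 a, (s : ℂ) * fourier 1 b) := by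
  have hc := continuous_pt hf hr hs
  have := torus_integral_eq (fun a b => fourier (-j) a * (fourier (-k) b *
      f ((r : ℂ) * fourier 1 a, (s : ℂ) * fourier 1 b)))
      (((map_continuous (fourier (-j))).comp continuous_fst).mul
        (((map_continuous (fourier (-k))).comp continuous_snd).mul hc))
  simp only [integral_const_mul] at this
  rw [← this]
  unfold torusCoeff UnitAddTorus.mFourierCoeff
  refine integral_congr_ae (.of_forall fun x => ?_)
  simp [UnitAddTorus.mFourier, torusPt, mul_assoc]

lemma torusCoeff_swap {f : ℂ × ℂ → ℂ} (hf : ContinuousOn f bidisk) {r s : ℝ}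
    (hr : r ∈ Set.Ico (0 : ℝ) 1) (hs : s ∈ Set.Ico (0 : ℝ) 1) (j k : ℤ) :
    torusCoeff f r s j k = torusCoeff (fun x => f x.swap) s r k j := by
  have hf' : ContinuousOn (fun x : ℂ × ℂ => f x.swap) bidisk :=
    hf.comp continuous_swap.continuousOn fun x hx => ⟨hx.2, hx.1⟩
  rw [torusCoeff_eq hf hr hs, torusCoeff_eq hf' hs hr]
  have hc := continuous_pt hf hr hs
  simp only [← integral_const_mul]
  rw [integral_integral_swap]
  · simp only [Prod.swap]
    refine integral_congr_ae (.of_forall fun x => integral_congr_ae (.of_forall fun y => ?_))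
    simp only
    ring
  · apply Continuous.integrable_of_hasCompactSupport _ (HasCompactSupport.of_compactSpace _)
    exact ((map_continuous (fourier (-j))).comp continuous_fst).mul
        (((map_continuous (fourier (-k))).comp continuous_snd).mul hc)

lemma half_mem : (1 / 2 : ℝ) ∈ Set.Ico (0 : ℝ) 1 := by norm_num

lemma torusCoeff_radius {f : ℂ × ℂ → ℂ} (hf : DifferentiableOn ℂ f bidisk) {r s : ℝ}
    (hr : r ∈ Set.Ico (0 : ℝ) 1) (hs : s ∈ Set.Ico (0 : ℝ) 1) (j k : ℤ) :
    torusCoeff f r s j k =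
      if 0 ≤ k then (2 * s : ℂ) ^ k.toNat * torusCoeff f r (1 / 2) j k else 0 := by
  have key (s : ℝ) (hs : s ∈ Set.Ico (0 : ℝ) 1) (a : UnitAddCircle) :=
    circle_coeff (h := fun w => f ((r : ℂ) * fourier 1 a, w)) (hf.comp (by fun_prop)
      fun w hw => ⟨(pt_mem hr hr a a).1, hw⟩) hs k
  rw [torusCoeff_eq hf.continuousOn hr hs, torusCoeff_eq hf.continuousOn hr half_mem]
  simp only [key s hs, key _ half_mem]
  split_ifs with hk
  · rw [← integral_const_mul]
    refine integral_congr_ae (.of_forall fun x => ?_)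
    have : ((1 / 2 : ℝ) : ℂ) ^ k.toNat * 2 ^ k.toNat = 1 := by
      rw [← mul_pow]; norm_num
    simp only [mul_pow]
    linear_combination (-(s : ℂ) ^ k.toNat * (fourier (-j) x *
      ((k.toNat.factorial : ℂ)⁻¹ *
        iteratedDeriv k.toNat (fun w => f ((r : ℂ) * fourier 1 x, w)) 0))) * this
  · simp

/-- The Taylor coefficients at the origin of a function holomorphic on the bidisk, as Cauchy
integrals over the torus of radius `1/2`. -/
def taylorCoeff (f : ℂ × ℂ → ℂ) (m : ℕ × ℕ) : ℂ :=
  2 ^ (m.1 + m.2) * torusCoeff f (1 / 2) (1 / 2) m.1 m.2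

lemma torusCoeff_eq_taylorCoeff {f : ℂ × ℂ → ℂ} (hf : DifferentiableOn ℂ f bidisk) {r s : ℝ}
    (hr : r ∈ Set.Ico (0 : ℝ) 1) (hs : s ∈ Set.Ico (0 : ℝ) 1) (j k : ℤ) :
    torusCoeff f r s j k = if 0 ≤ j ∧ 0 ≤ k then
      taylorCoeff f (j.toNat, k.toNat) * (r : ℂ) ^ j.toNat * (s : ℂ) ^ k.toNat else 0 := by
  have hf' : DifferentiableOn ℂ (fun x : ℂ × ℂ => f x.swap) bidisk :=
    hf.comp (f := Prod.swap)
      ((ContinuousLinearEquiv.prodComm ℂ ℂ ℂ).differentiable.differentiableOn)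
      fun x hx => ⟨hx.2, hx.1⟩
  rw [torusCoeff_radius hf hr hs, torusCoeff_swap hf.continuousOn hr half_mem,
    torusCoeff_radius hf' half_mem hr, ← torusCoeff_swap hf.continuousOn half_mem half_mem]
  by_cases hk : 0 ≤ k <;> by_cases hj : 0 ≤ j <;> simp only [hk, hj, if_true, if_false, and_self,
    and_true, and_false, mul_zero]
  rw [taylorCoeff, Int.toNat_of_nonneg hj, Int.toNat_of_nonneg hk, mul_pow, mul_pow, pow_add]
  ring

/-- The embedding of the non-negative frequencies into all frequencies. -/
def freq (m : ℕ × ℕ) : Fin 2 → ℤ := ![(m.1 : ℤ), (m.2 : ℤ)]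

lemma freq_injective : Function.Injective freq := by
  rintro ⟨a, b⟩ ⟨c, d⟩ h
  have h0 := congrFun h 0
  have h1 := congrFun h 1
  simp [freq] at h0 h1
  simp [h0, h1]

/-- The restriction of `f` to a torus, as a continuous function of the angles. -/
def restrict {f : ℂ × ℂ → ℂ} (hf : ContinuousOn f bidisk) {r s : ℝ}
    (hr : r ∈ Set.Ico (0 : ℝ) 1) (hs : s ∈ Set.Ico (0 : ℝ) 1) : C(UnitAddTorus (Fin 2), ℂ) :=
  ⟨fun x => f (torusPt r s x),
    hf.comp_continuous (continuous_torusPt r s) fun x => pt_mem hr hs (x 0) (x 1)⟩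

lemma mFourierCoeff_restrict_freq {f : ℂ × ℂ → ℂ} (hf : DifferentiableOn ℂ f bidisk) {r s : ℝ}
    (hr : r ∈ Set.Ico (0 : ℝ) 1) (hs : s ∈ Set.Ico (0 : ℝ) 1) (m : ℕ × ℕ) :
    UnitAddTorus.mFourierCoeff (restrict hf.continuousOn hr hs) (freq m) =
      taylorCoeff f m * (r : ℂ) ^ m.1 * (s : ℂ) ^ m.2 := by
  refine (torusCoeff_eq_taylorCoeff hf hr hs m.1 m.2).trans ?_
  simp

lemma mFourierCoeff_restrict_eq_zero {f : ℂ × ℂ → ℂ} (hf : DifferentiableOn ℂ f bidisk) {r s : ℝ}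
    (hr : r ∈ Set.Ico (0 : ℝ) 1) (hs : s ∈ Set.Ico (0 : ℝ) 1) (n : Fin 2 → ℤ)
    (hn : n ∉ Set.range freq) :
    UnitAddTorus.mFourierCoeff (restrict hf.continuousOn hr hs) n = 0 := by
  have h := torusCoeff_eq_taylorCoeff hf hr hs (n 0) (n 1)
  have e : ![n 0, n 1] = n := by ext i; fin_cases i <;> rfl
  rw [torusCoeff, e, if_neg] at h
  · exact h
  · rintro ⟨h0, h1⟩
    refine hn ⟨((n 0).toNat, (n 1).toNat), ?_⟩
    rw [← e]
    simp [freq, h0, h1]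

lemma torusMean_eq_integral {f : ℂ × ℂ → ℂ} (hf : ContinuousOn f bidisk) {r : ℝ}
    (hr : r ∈ Set.Ico (0 : ℝ) 1) :
    torusMean f r = ∫ x : UnitAddTorus (Fin 2), ‖f (torusPt r r x)‖ ^ 2 := by
  have hc := continuous_pt hf hr hr
  have := torus_integral_eq (fun a b => ‖f ((r : ℂ) * fourier 1 a, (r : ℂ) * fourier 1 b)‖ ^ 2)
    (hc.norm.pow 2)
  unfold torusPt
  rw [this, torusMean, ← circle_integral_eq]
  refine integral_congr_ae (.of_forall fun a => ?_)
  exact (circle_integral_eq (fun w => ‖f ((r : ℂ) * fourier 1 a, w)‖ ^ 2) r).symm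

lemma hasSum_torusMean {f : ℂ × ℂ → ℂ} (hf : DifferentiableOn ℂ f bidisk) {r : ℝ}
    (hr : r ∈ Set.Ico (0 : ℝ) 1) :
    HasSum (fun m : ℕ × ℕ => ‖taylorCoeff f m‖ ^ 2 * (r ^ (m.1 + m.2)) ^ 2) (torusMean f r) := by
  have h := UnitAddTorus.hasSum_sq_mFourierCoeff
    (ContinuousMap.toLp 2 volume ℂ (restrict hf.continuousOn hr hr))
  simp only [UnitAddTorus.mFourierCoeff_toLp] at h
  rw [← freq_injective.hasSum_iff (fun n hn => by
    rw [mFourierCoeff_restrict_eq_zero hf hr hr n hn]; simp)] at h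
  have e : ∫ t : UnitAddTorus (Fin 2),
      ‖ContinuousMap.toLp 2 volume ℂ (restrict hf.continuousOn hr hr) t‖ ^ 2 = torusMean f r := by
    rw [torusMean_eq_integral hf.continuousOn hr]
    refine integral_congr_ae ?_
    filter_upwards [ContinuousMap.coeFn_toLp (p := 2) (𝕜 := ℂ) volume
      (restrict hf.continuousOn hr hr)] with x hx
    rw [hx]
    rfl
  rw [e] at h
  convert! h using 2 with m
  rw [Function.comp, mFourierCoeff_restrict_freq hf hr hr m]
  simp only [norm_mul, norm_pow, norm_real, Real.norm_eq_abs, abs_of_nonneg hr.1]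
  ring

lemma hasSum_taylor {f : ℂ × ℂ → ℂ} (hf : DifferentiableOn ℂ f bidisk)
    (hs : ∀ r ∈ Set.Ico (0 : ℝ) 1, ∀ s ∈ Set.Ico (0 : ℝ) 1,
      Summable fun m : ℕ × ℕ => taylorCoeff f m * (r : ℂ) ^ m.1 * (s : ℂ) ^ m.2)
    {z w : ℂ} (hzw : (z, w) ∈ bidisk) :
    HasSum (fun m : ℕ × ℕ => taylorCoeff f m * z ^ m.1 * w ^ m.2) (f (z, w)) := by
  have polar (z : ℂ) (hz : z ∈ ball (0 : ℂ) 1) : ∃ r ∈ Set.Ico (0 : ℝ) 1, ∃ x : UnitAddCircle,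
      (r : ℂ) * fourier 1 x = z := by
    refine ⟨‖z‖, ⟨norm_nonneg _, by simpa using hz⟩, ((z.arg / (2 * Real.pi) : ℝ) : UnitAddCircle), ?_⟩
    rw [fourier_coe_apply]
    conv_rhs => rw [← Complex.norm_mul_exp_arg_mul_I z]
    congr 2
    have : (Real.pi : ℂ) ≠ 0 := by exact_mod_cast Real.pi_ne_zero
    push_cast
    field_simp
  obtain ⟨r, hr, x, rfl⟩ := polar z hzw.1
  obtain ⟨s, hs', y, rfl⟩ := polar w hzw.2
  have hsum : Summable (UnitAddTorus.mFourierCoeff (restrict hf.continuousOn hr hs')) := by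
    rw [← freq_injective.summable_iff (fun n hn => mFourierCoeff_restrict_eq_zero hf hr hs' n hn)]
    convert! hs r hr s hs' using 2 with m
    exact mFourierCoeff_restrict_freq hf hr hs' m
  have h := UnitAddTorus.hasSum_mFourier_series_apply_of_summable hsum ![x, y]
  rw [← freq_injective.hasSum_iff (fun n hn => by
    rw [mFourierCoeff_restrict_eq_zero hf hr hs' n hn]; simp)] at h
  convert! h using 2 with m
  rw [Function.comp, mFourierCoeff_restrict_freq hf hr hs' m]
  have : UnitAddTorus.mFourier (freq m) ![x, y] = fourier 1 x ^ m.1 * fourier 1 y ^ m.2 := by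
    rw [← fourier_pow, ← fourier_pow]
    simp [UnitAddTorus.mFourier, freq]
  rw [this, smul_eq_mul]
  ring

lemma summable_monomials {a : ℕ × ℕ → ℂ} {C : ℝ} (ha : ∀ m, ‖a m‖ ≤ C) {z w : ℂ}
    (h : (z, w) ∈ bidisk) : Summable fun m : ℕ × ℕ => ‖a m * z ^ m.1 * w ^ m.2‖ := by
  have hz : ‖z‖ < 1 := by simpa using h.1
  have hw : ‖w‖ < 1 := by simpa using h.2
  have h1 := ((summable_geometric_of_lt_one (norm_nonneg z) hz).mul_of_nonneg
    (summable_geometric_of_lt_one (norm_nonneg w) hw) (fun n => by positivity)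
    (fun n => by positivity)).mul_left C
  refine h1.of_nonneg_of_le (fun m => norm_nonneg _) fun m => ?_
  rw [norm_mul, norm_mul, norm_pow, norm_pow, mul_assoc]
  gcongr
  exact ha m

lemma hasFDerivAt_monomial {E : Type*} [NormedAddCommGroup E] [NormedSpace ℂ E]
    (φ ψ : E →L[ℂ] ℂ) (c : ℂ) (m : ℕ × ℕ) (x : E) :
    HasFDerivAt (fun x => c * φ x ^ m.1 * ψ x ^ m.2)
      ((c * (((m.1 : ℂ) * φ x ^ (m.1 - 1)) * ψ x ^ m.2)) • φ +
        (c * (φ x ^ m.1 * ((m.2 : ℂ) * ψ x ^ (m.2 - 1)))) • ψ) x := by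
  have h1 := ((hasDerivAt_pow m.1 (φ x)).comp_hasFDerivAt x φ.hasFDerivAt).const_mul c
  have h2 := (hasDerivAt_pow m.2 (ψ x)).comp_hasFDerivAt x ψ.hasFDerivAt
  refine (h1.mul h2).congr_fderiv ?_
  ext v
  simp
  ring

lemma differentiableAt_series {E : Type*} [NormedAddCommGroup E] [NormedSpace ℂ E]
    (φ ψ : E →L[ℂ] ℂ) {a : ℕ × ℕ → ℂ} {C : ℝ} (ha : ∀ m, ‖a m‖ ≤ C) {x₀ : E}
    (hz : ‖φ x₀‖ < 1) (hw : ‖ψ x₀‖ < 1) :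
    DifferentiableAt ℂ (fun x : E => ∑' m : ℕ × ℕ, a m * φ x ^ m.1 * ψ x ^ m.2) x₀ := by
  obtain ⟨R, hR, hR1⟩ := exists_between (max_lt hz hw)
  obtain ⟨hzR, hwR⟩ := max_lt_iff.1 hR
  have hR0 : 0 < R := (norm_nonneg _).trans_lt hzR
  have hC : 0 ≤ C := (norm_nonneg _).trans (ha 0)
  have s0 : Summable fun n : ℕ => R ^ n := summable_geometric_of_lt_one hR0.le hR1
  have s1 : Summable fun n : ℕ => (n : ℝ) * R ^ (n - 1) := by
    have := (hasSum_coe_mul_geometric_of_norm_lt_one (r := R)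
      (by rwa [Real.norm_eq_abs, abs_of_pos hR0])).summable.mul_right R⁻¹
    refine this.congr fun n => ?_
    cases n with
    | zero => simp
    | succ n => rw [Nat.add_sub_cancel, pow_succ]; field_simp
  have hu : Summable fun m : ℕ × ℕ =>
      C * ((((m.1 : ℝ) * R ^ (m.1 - 1)) * R ^ m.2) * ‖φ‖ +
        (R ^ m.1 * ((m.2 : ℝ) * R ^ (m.2 - 1))) * ‖ψ‖) :=
    (((s1.mul_of_nonneg s0 (fun n => by positivity) (fun n => by positivity)).mul_right _).add
      ((s0.mul_of_nonneg s1 (fun n => by positivity) (fun n => by positivity)).mul_right _)).mul_left C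
  have hopen : IsOpen (φ ⁻¹' ball 0 R ∩ ψ ⁻¹' ball 0 R) :=
    (isOpen_ball.preimage φ.continuous).inter (isOpen_ball.preimage ψ.continuous)
  have hconv : Convex ℝ (φ ⁻¹' ball 0 R ∩ ψ ⁻¹' ball 0 R) :=
    ((convex_ball (0 : ℂ) R).linear_preimage (φ.toLinearMap.restrictScalars ℝ)).inter
      ((convex_ball (0 : ℂ) R).linear_preimage (ψ.toLinearMap.restrictScalars ℝ))
  have hmem : x₀ ∈ φ ⁻¹' ball 0 R ∩ ψ ⁻¹' ball 0 R := ⟨by simpa using hzR, by simpa using hwR⟩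
  have hs0 : Summable fun m : ℕ × ℕ => a m * φ x₀ ^ m.1 * ψ x₀ ^ m.2 :=
    (summable_monomials ha (z := φ x₀) (w := ψ x₀) ⟨by simpa using hz, by simpa using hw⟩).of_norm
  refine (hasFDerivAt_tsum_of_isPreconnected (x₀ := x₀)
    (f := fun (m : ℕ × ℕ) x => a m * φ x ^ m.1 * ψ x ^ m.2)
    (f' := fun m x => (a m * (((m.1 : ℂ) * φ x ^ (m.1 - 1)) * ψ x ^ m.2)) • φ +
      (a m * (φ x ^ m.1 * ((m.2 : ℂ) * ψ x ^ (m.2 - 1)))) • ψ) hu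
    hopen hconv.isPreconnected (fun m x _ => ?_) (fun m x hx => ?_) hmem
    hs0 hmem).differentiableAt
  · exact hasFDerivAt_monomial φ ψ (a m) m x
  · have hx1 : ‖φ x‖ ≤ R := (mem_ball_zero_iff.1 hx.1).le
    have hx2 : ‖ψ x‖ ≤ R := (mem_ball_zero_iff.1 hx.2).le
    rw [mul_add]
    refine (norm_add_le _ _).trans (add_le_add ?_ ?_)
    all_goals
      simp only [norm_smul, norm_mul, norm_pow, Complex.norm_natCast]
      rw [mul_assoc ‖a m‖]
      refine mul_le_mul (ha m) ?_ (by positivity) hC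
      gcongr

lemma differentiableOn_series {a : ℕ × ℕ → ℂ} {C : ℝ} (ha : ∀ m, ‖a m‖ ≤ C) :
    DifferentiableOn ℂ (fun x : ℂ × ℂ => ∑' m : ℕ × ℕ, a m * x.1 ^ m.1 * x.2 ^ m.2) bidisk :=
  fun x hx => (differentiableAt_series (ContinuousLinearMap.fst ℂ ℂ ℂ)
    (ContinuousLinearMap.snd ℂ ℂ ℂ) ha (by simpa using hx.1)
    (by simpa using hx.2)).differentiableWithinAt

lemma integral_mFourier (n : Fin 2 → ℤ) :
    ∫ x : UnitAddTorus (Fin 2), UnitAddTorus.mFourier n x = if n = 0 then 1 else 0 := by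
  have h := (orthonormal_iff_ite.1 (UnitAddTorus.orthonormal_mFourier (d := Fin 2))) 0 n
  rw [ContinuousMap.inner_toLp] at h
  simp only [UnitAddTorus.mFourier_zero, ContinuousMap.one_apply, map_one, mul_one] at h
  refine Eq.trans h ?_
  simp only [eq_comm]

lemma taylorCoeff_series {a : ℕ × ℕ → ℂ} {C : ℝ} (ha : ∀ m, ‖a m‖ ≤ C) {f : ℂ × ℂ → ℂ}
    (hf : ∀ x ∈ bidisk, f x = ∑' m : ℕ × ℕ, a m * x.1 ^ m.1 * x.2 ^ m.2) :
    taylorCoeff f = a := by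
  have hd : DifferentiableOn ℂ f bidisk := (differentiableOn_series ha).congr hf
  have hpt : (((1 / 2 : ℝ) : ℂ), ((1 / 2 : ℝ) : ℂ)) ∈ bidisk := by
    constructor <;> simp <;> norm_num
  ext n
  set c : ℕ × ℕ → ℂ := fun m => a m * ((1 / 2 : ℝ) : ℂ) ^ m.1 * ((1 / 2 : ℝ) : ℂ) ^ m.2 with hc
  have hsum : Summable fun m => ‖c m‖ := summable_monomials ha hpt
  have hF : ∀ x : UnitAddTorus (Fin 2),
      HasSum (fun m : ℕ × ℕ => c m * UnitAddTorus.mFourier (freq m - freq n) x)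
        (UnitAddTorus.mFourier (-freq n) x • restrict hd.continuousOn half_mem half_mem x) := by
    intro x
    have hmem := pt_mem half_mem half_mem (x 0) (x 1)
    have h := ((summable_monomials ha hmem).of_norm.hasSum).mul_left
      (UnitAddTorus.mFourier (-freq n) x)
    convert! h using 2 with m
    · rw [sub_eq_add_neg, UnitAddTorus.mFourier_add]
      have : UnitAddTorus.mFourier (freq m) x = fourier 1 (x 0) ^ m.1 * fourier 1 (x 1) ^ m.2 := by
        rw [← fourier_pow, ← fourier_pow]
        simp [UnitAddTorus.mFourier, freq]
      rw [this, hc]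
      ring
    · exact hf _ hmem
  have hint := hasSum_integral_of_summable_integral_norm
    (μ := (volume : Measure (UnitAddTorus (Fin 2))))
    (F := fun (m : ℕ × ℕ) x => c m * UnitAddTorus.mFourier (freq m - freq n) x) (fun m => by
      apply Continuous.integrable_of_hasCompactSupport (by fun_prop)
        (HasCompactSupport.of_compactSpace _)) (by
      have hn (k : Fin 2 → ℤ) (x : UnitAddTorus (Fin 2)) : ‖UnitAddTorus.mFourier k x‖ = 1 := by
        simp only [UnitAddTorus.mFourier, ContinuousMap.coe_mk, norm_prod, norm_fourier_apply,
          Finset.prod_const_one]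
      simpa only [norm_mul (c _), hn, mul_one, integral_const, probReal_univ, one_smul] using hsum)
  have e1 : (∫ x : UnitAddTorus (Fin 2),
      ∑' m : ℕ × ℕ, c m * UnitAddTorus.mFourier (freq m - freq n) x) =
      UnitAddTorus.mFourierCoeff (restrict hd.continuousOn half_mem half_mem) (freq n) :=
    integral_congr_ae (.of_forall fun x => (hF x).tsum_eq)
  rw [e1, mFourierCoeff_restrict_freq hd half_mem half_mem n] at hint
  have h2 := hint.unique (a₂ := c n) (by
    simp only [integral_const_mul, integral_mFourier]
    convert! hasSum_ite_eq n (c n) using 2 with m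
    by_cases hm : m = n
    · subst hm; simp
    · rw [if_neg, if_neg hm, mul_zero]
      exact fun h => hm (freq_injective (sub_eq_zero.1 h)))
  have h3 : ((1 / 2 : ℝ) : ℂ) ≠ 0 := by norm_num
  rw [hc] at h2
  exact mul_right_cancel₀ (pow_ne_zero _ h3) (mul_right_cancel₀ (pow_ne_zero _ h3) h2)

lemma taylorCoeff_add {f g : ℂ × ℂ → ℂ} (hf : ContinuousOn f bidisk) (hg : ContinuousOn g bidisk) :
    taylorCoeff (f + g) = taylorCoeff f + taylorCoeff g := by
  ext m
  have h (f : ℂ × ℂ → ℂ) (hf : ContinuousOn f bidisk) : Integrable fun x : UnitAddTorus (Fin 2) =>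
      UnitAddTorus.mFourier (-![(m.1 : ℤ), (m.2 : ℤ)]) x • f (torusPt (1 / 2) (1 / 2) x) :=
    Continuous.integrable_of_hasCompactSupport
      (((UnitAddTorus.mFourier (-![(m.1 : ℤ), (m.2 : ℤ)])) *
        restrict hf half_mem half_mem).continuous) (HasCompactSupport.of_compactSpace _)
  have := integral_add (h f hf) (h g hg)
  simp only [taylorCoeff, torusCoeff, UnitAddTorus.mFourierCoeff, Pi.add_apply, smul_add] at this ⊢
  rw [this, mul_add]

lemma taylorCoeff_smul (c : ℂ) (f : ℂ × ℂ → ℂ) : taylorCoeff (c • f) = c • taylorCoeff f := by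
  ext m
  simp only [taylorCoeff, torusCoeff, UnitAddTorus.mFourierCoeff, Pi.smul_apply, smul_eq_mul,
    mul_left_comm _ c, integral_const_mul]

lemma torusMean_nonneg (f : ℂ × ℂ → ℂ) (r : ℝ) : 0 ≤ torusMean f r := by
  have h (g : ℂ → ℝ) (hg : ∀ z, 0 ≤ g z) : 0 ≤ Real.circleAverage g 0 r := by
    rw [Real.circleAverage_def]
    exact smul_nonneg (by positivity)
      (intervalIntegral.integral_nonneg (by positivity) fun x _ => hg _)
  exact h _ fun z => h _ fun w => by positivity

lemma torusMean_le {f g : ℂ × ℂ → ℂ} (hf : ContinuousOn f bidisk) (hg : ContinuousOn g bidisk)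
    {C : ℝ} (h : ∀ x ∈ bidisk, ‖f x‖ ^ 2 ≤ C * ‖g x‖ ^ 2) {r : ℝ} (hr : r ∈ Set.Ico (0 : ℝ) 1) :
    torusMean f r ≤ C * torusMean g r := by
  rw [torusMean_eq_integral hf hr, torusMean_eq_integral hg hr, ← integral_const_mul]
  refine integral_mono ?_ ?_ fun x => h _ (pt_mem hr hr (x 0) (x 1))
  · exact Continuous.integrable_of_hasCompactSupport ((restrict hf hr hr).continuous.norm.pow 2)
      (HasCompactSupport.of_compactSpace _)
  · exact Continuous.integrable_of_hasCompactSupport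
      (((restrict hg hr hr).continuous.norm.pow 2).const_mul C)
      (HasCompactSupport.of_compactSpace _)

lemma sum_le_of_bound {f : ℂ × ℂ → ℂ} (hf : DifferentiableOn ℂ f bidisk) {B : ℝ}
    (hB : B ∈ upperBounds (torusMean f '' Set.Ico 0 1)) (S : Finset (ℕ × ℕ)) :
    ∑ m ∈ S, ‖taylorCoeff f m‖ ^ 2 ≤ B := by
  have hcont : Continuous fun r : ℝ => ∑ m ∈ S, ‖taylorCoeff f m‖ ^ 2 * (r ^ (m.1 + m.2)) ^ 2 := by
    fun_prop
  have ht := (hcont.tendsto 1).mono_left (nhdsWithin_le_nhds (s := Set.Iio 1))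
  simp only [one_pow, mul_one] at ht
  refine le_of_tendsto ht ?_
  filter_upwards [Ico_mem_nhdsLT (show (0 : ℝ) < 1 by norm_num)] with r hr
  exact (sum_le_hasSum S (fun m _ => by positivity) (hasSum_torusMean hf hr)).trans
    (hB ⟨r, hr, rfl⟩)

lemma isLUB_torusMean {f : ℂ × ℂ → ℂ} (hf : DifferentiableOn ℂ f bidisk)
    (hs : Summable fun m => ‖taylorCoeff f m‖ ^ 2) :
    IsLUB (torusMean f '' Set.Ico 0 1) (∑' m, ‖taylorCoeff f m‖ ^ 2) := by
  constructor
  · rintro _ ⟨r, hr, rfl⟩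
    refine hasSum_le (fun m => ?_) (hasSum_torusMean hf hr) hs.hasSum
    exact mul_le_of_le_one_right (by positivity)
      (pow_le_one₀ (pow_nonneg hr.1 _) (pow_le_one₀ hr.1 hr.2.le))
  · intro B hB
    refine hs.tsum_le_of_sum_le fun S => ?_
    exact sum_le_of_bound hf hB S

lemma summable_of_bddAbove {f : ℂ × ℂ → ℂ} (hf : DifferentiableOn ℂ f bidisk)
    (hB : BddAbove (torusMean f '' Set.Ico 0 1)) : Summable fun m => ‖taylorCoeff f m‖ ^ 2 := by
  obtain ⟨B, hB⟩ := hB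
  exact summable_of_sum_le (fun m => by positivity) (sum_le_of_bound hf hB)

end Fourier

/-! ### The Hardy space over the bidisk -/

noncomputable section Hardy

/-- Holomorphic functions `f` on the bidisk with `sup_{0 ≤ r < 1} ∫ |f(rz, rw)|² dm < ∞`.
A function on the bidisk is represented by its extension by zero to `ℂ × ℂ`. -/
def hardySubmodule : Submodule ℂ (ℂ × ℂ → ℂ) where
  carrier := {f | DifferentiableOn ℂ f bidisk ∧ (∀ x ∉ bidisk, f x = 0) ∧
    BddAbove (torusMean f '' Set.Ico 0 1)}
  zero_mem' := by
    refine ⟨differentiableOn_const 0, fun _ _ => rfl, 0, ?_⟩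
    rintro _ ⟨r, -, rfl⟩
    simp [torusMean, Real.circleAverage_def]
  add_mem' := by
    rintro f g ⟨hf, hf0, hfB⟩ ⟨hg, hg0, hgB⟩
    refine ⟨hf.add hg, fun x hx => by simp [hf0 x hx, hg0 x hx], ?_⟩
    have hs : Summable fun m => ‖taylorCoeff (f + g) m‖ ^ 2 := by
      have h1 := ((summable_of_bddAbove hf hfB).add (summable_of_bddAbove hg hgB)).mul_left 2
      refine h1.of_nonneg_of_le (fun m => by positivity) fun m => ?_
      rw [taylorCoeff_add hf.continuousOn hg.continuousOn, Pi.add_apply]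
      have h2 := norm_add_le (taylorCoeff f m) (taylorCoeff g m)
      nlinarith [sq_nonneg (‖taylorCoeff f m‖ - ‖taylorCoeff g m‖),
        norm_nonneg (taylorCoeff f m + taylorCoeff g m)]
    exact (isLUB_torusMean (hf.add hg) hs).bddAbove
  smul_mem' := by
    rintro c f ⟨hf, hf0, hfB⟩
    refine ⟨hf.const_smul c, fun x hx => by simp [hf0 x hx], ?_⟩
    obtain ⟨B, hB⟩ := hfB
    refine ⟨‖c‖ ^ 2 * B, ?_⟩
    rintro _ ⟨r, hr, rfl⟩
    refine (torusMean_le (hf.const_smul c).continuousOn hf.continuousOn (C := ‖c‖ ^ 2)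
      (fun x _ => ?_) hr).trans (by gcongr; exact hB ⟨r, hr, rfl⟩)
    rw [Pi.smul_apply, norm_smul, mul_pow]

/-- The Hardy space `H²(𝔻²)`. -/
def H2 : Type := hardySubmodule

instance : AddCommGroup H2 := inferInstanceAs (AddCommGroup hardySubmodule)

instance : Module ℂ H2 := inferInstanceAs (Module ℂ hardySubmodule)

instance : CoeFun H2 fun _ => ℂ × ℂ → ℂ := ⟨fun f => f.1⟩

/-- Two elements of `H²` that agree on the bidisk are equal. -/
lemma H2.ext {f g : H2} (h : ∀ x ∈ bidisk, f x = g x) : f = g := by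
  refine Subtype.ext (funext fun x => ?_)
  by_cases hx : x ∈ bidisk
  · exact h x hx
  · exact (f.2.2.1 x hx).trans (g.2.2.1 x hx).symm

lemma H2.memℓp (f : H2) : Memℓp (taylorCoeff f) 2 := by
  rw [memℓp_gen_iff (by simp)]
  simpa using summable_of_bddAbove f.2.1 f.2.2.2

/-- The Taylor coefficients of an element of `H²`, as a linear map into `ℓ²`. -/
def toCoeff : H2 →ₗ[ℂ] lp (fun _ : ℕ × ℕ => ℂ) 2 where
  toFun f := ⟨taylorCoeff f, f.memℓp⟩
  map_add' f g := Subtype.ext (taylorCoeff_add f.2.1.continuousOn g.2.1.continuousOn)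
  map_smul' c f := Subtype.ext (taylorCoeff_smul c f)

lemma toCoeff_apply (f : H2) (m : ℕ × ℕ) : toCoeff f m = taylorCoeff f m := rfl

lemma H2.hasSum (f : H2) {z w : ℂ} (h : (z, w) ∈ bidisk) :
    HasSum (fun m : ℕ × ℕ => toCoeff f m * z ^ m.1 * w ^ m.2) (f (z, w)) := by
  refine hasSum_taylor f.2.1 (fun r hr s hs => ?_) h
  refine (summable_monomials (C := ‖toCoeff f‖) (a := taylorCoeff f)
    (fun m => lp.norm_apply_le_norm (by simp) (toCoeff f) m) ?_).of_norm
  simpa using pt_mem hr hs 0 0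

lemma toCoeff_bijective : Function.Bijective toCoeff := by
  constructor
  · intro f g hfg
    refine H2.ext fun x hx => (f.hasSum hx).unique ?_
    rw [hfg]
    exact g.hasSum hx
  · intro a
    classical
    have ha : ∀ m, ‖a m‖ ≤ ‖a‖ := fun m => lp.norm_apply_le_norm (by simp) a m
    set f : ℂ × ℂ → ℂ :=
      bidisk.indicator fun x => ∑' m : ℕ × ℕ, a m * x.1 ^ m.1 * x.2 ^ m.2 with hf
    have hfx : ∀ x ∈ bidisk, f x = ∑' m : ℕ × ℕ, a m * x.1 ^ m.1 * x.2 ^ m.2 :=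
      fun x hx => Set.indicator_of_mem hx _
    have hd : DifferentiableOn ℂ f bidisk := (differentiableOn_series ha).congr hfx
    have hc : taylorCoeff f = a := taylorCoeff_series ha hfx
    have hs : Summable fun m => ‖taylorCoeff f m‖ ^ 2 := by
      have := lp.memℓp a
      rw [memℓp_gen_iff (by simp)] at this
      rw [hc]
      simpa using this
    exact ⟨⟨f, hd, fun x hx => Set.indicator_of_notMem hx _, (isLUB_torusMean hd hs).bddAbove⟩,
      Subtype.ext hc⟩

/-- The norm `‖f‖² = sup_{0 ≤ r < 1} ∫ |f(rz, rw)|² dm`. -/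
def hardyNorm (f : H2) : ℝ := √(sSup (torusMean f '' Set.Ico 0 1))

lemma hardyNorm_eq (f : H2) : hardyNorm f = ‖toCoeff f‖ := by
  have h := (isLUB_torusMean f.2.1 (summable_of_bddAbove f.2.1 f.2.2.2)).csSup_eq
    ⟨_, 0, by simp, rfl⟩
  have h2 := lp.norm_rpow_eq_tsum (p := 2) (by simp) (toCoeff f)
  simp only [ENNReal.toReal_ofNat, Real.rpow_ofNat] at h2
  rw [hardyNorm, h, Real.sqrt_eq_iff_mul_self_eq (by positivity) (by positivity), ← sq, h2]
  rfl

instance : NormedAddCommGroup H2 := AddGroupNorm.toNormedAddCommGroup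
  { toFun := hardyNorm
    map_zero' := by simp [hardyNorm_eq]
    add_le' := fun f g => by simpa [hardyNorm_eq] using norm_add_le _ _
    neg' := fun f => by simp [hardyNorm_eq]
    eq_zero_of_map_eq_zero' := fun f hf => toCoeff_bijective.1 (by
      rw [hardyNorm_eq, norm_eq_zero] at hf
      rw [hf, map_zero]) }

lemma H2.norm_def (f : H2) : ‖f‖ = hardyNorm f := rfl

instance : NormedSpace ℂ H2 where
  norm_smul_le c f := by simp [H2.norm_def, hardyNorm_eq, norm_smul]

instance : InnerProductSpace ℂ H2 := InnerProductSpace.ofNorm ℂ fun f g => by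
  simpa only [H2.norm_def, hardyNorm_eq, map_add, map_sub, sq] using
    parallelogram_law_with_norm ℂ (toCoeff f) (toCoeff g)

/-- The unitary identification of `H²(𝔻²)` with `ℓ²(ℕ × ℕ)` by Taylor coefficients. -/
def coeffEquiv : H2 ≃ₗᵢ[ℂ] lp (fun _ : ℕ × ℕ => ℂ) 2 where
  toLinearEquiv := LinearEquiv.ofBijective toCoeff toCoeff_bijective
  norm_map' f := (hardyNorm_eq f).symm

instance : CompleteSpace H2 :=
  (completeSpace_congr coeffEquiv.toIsometryEquiv.isometry.isUniformEmbedding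
    (e := coeffEquiv.toEquiv)).2 inferInstance

/-! ### Polynomials, multiplication operators and quotient modules -/

/-- The value of `p ∈ ℂ[z, w]` at a point; `z` is the variable `0` and `w` the variable `1`. -/
def evalAt (p : MvPolynomial (Fin 2) ℂ) (x : ℂ × ℂ) : ℂ := MvPolynomial.eval ![x.1, x.2] p

lemma differentiable_evalAt (p : MvPolynomial (Fin 2) ℂ) : Differentiable ℂ (evalAt p) := by
  unfold evalAt
  induction p using MvPolynomial.induction_on with
  | C a => simp
  | add p q hp hq =>
    simp only [map_add]
    exact hp.add hq
  | mul_X p i hp =>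
    simp only [map_mul, MvPolynomial.eval_X]
    refine hp.mul ?_
    fin_cases i
    · exact differentiable_fst
    · exact differentiable_snd

lemma exists_bound_evalAt (p : MvPolynomial (Fin 2) ℂ) :
    ∃ C : ℝ, 0 ≤ C ∧ ∀ x ∈ bidisk, ‖evalAt p x‖ ≤ C := by
  obtain ⟨C, hC⟩ := ((isCompact_closedBall (0 : ℂ) 1).prod (isCompact_closedBall (0 : ℂ) 1))
    |>.exists_bound_of_continuousOn (differentiable_evalAt p).continuous.continuousOn
  exact ⟨C, (norm_nonneg _).trans (hC (0, 0) (by simp)), fun x hx =>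
    hC x ⟨ball_subset_closedBall hx.1, ball_subset_closedBall hx.2⟩⟩

lemma mul_mem_hardy (p : MvPolynomial (Fin 2) ℂ) (f : H2) :
    (fun x => evalAt p x * f x) ∈ hardySubmodule := by
  obtain ⟨C, -, hC⟩ := exists_bound_evalAt p
  have hd : DifferentiableOn ℂ (fun x => evalAt p x * f x) bidisk :=
    (differentiable_evalAt p).differentiableOn.mul f.2.1
  obtain ⟨B, hB⟩ := f.2.2.2
  refine ⟨hd, fun x hx => by simp [f.2.2.1 x hx], C ^ 2 * B, ?_⟩
  rintro _ ⟨r, hr, rfl⟩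
  refine (torusMean_le hd.continuousOn f.2.1.continuousOn (C := C ^ 2) (fun x hx => ?_) hr).trans
    (by gcongr; exact hB ⟨r, hr, rfl⟩)
  rw [norm_mul, mul_pow]
  gcongr
  exact hC x hx

/-- The analytic Toeplitz operator `f ↦ p f` on `H²(𝔻²)`. -/
def toeplitz (p : MvPolynomial (Fin 2) ℂ) : H2 →L[ℂ] H2 :=
  LinearMap.mkContinuousOfExistsBound
    { toFun := fun f => ⟨fun x => evalAt p x * f x, mul_mem_hardy p f⟩
      map_add' := fun f g => Subtype.ext (funext fun x => mul_add (evalAt p x) (f x) (g x))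
      map_smul' := fun c f => Subtype.ext (funext fun x => mul_left_comm (evalAt p x) c (f x)) }
    (by
      obtain ⟨C, hC0, hC⟩ := exists_bound_evalAt p
      refine ⟨C, fun f => ?_⟩
      rw [H2.norm_def, H2.norm_def, hardyNorm, hardyNorm]
      refine Real.sqrt_le_iff.2 ⟨by positivity, ?_⟩
      rw [mul_pow, Real.sq_sqrt
        (Real.sSup_nonneg (by rintro _ ⟨r, -, rfl⟩; exact torusMean_nonneg _ _))]
      refine csSup_le ⟨_, 0, by simp, rfl⟩ ?_
      rintro _ ⟨r, hr, rfl⟩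
      refine (torusMean_le (mul_mem_hardy p f).1.continuousOn f.2.1.continuousOn (C := C ^ 2)
        (fun x hx => ?_) hr).trans (by gcongr; exact le_csSup f.2.2.2 ⟨r, hr, rfl⟩)
      rw [norm_mul, mul_pow]
      gcongr
      exact hC x hx)

/-- The constant function `1` as an element of `H²(𝔻²)`. -/
def one : H2 := ⟨bidisk.indicator 1, by
  have hd : DifferentiableOn ℂ (bidisk.indicator (1 : ℂ × ℂ → ℂ)) bidisk :=
    (differentiableOn_const (1 : ℂ)).congr fun x hx => Set.indicator_of_mem hx _
  refine ⟨hd, fun x hx => Set.indicator_of_notMem hx _, 1, ?_⟩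
  rintro _ ⟨r, hr, rfl⟩
  have h (z : ℂ) (hz : z ∈ sphere (0 : ℂ) |r|) : z ∈ ball (0 : ℂ) 1 := by
    rw [abs_of_nonneg hr.1, mem_sphere_zero_iff_norm] at hz
    simpa [hz] using hr.2
  have h1 : torusMean (bidisk.indicator 1) r = Real.circleAverage (fun _ => (1 : ℝ)) 0 r := by
    refine Real.circleAverage_congr_sphere fun z hz => ?_
    refine (Real.circleAverage_congr_sphere (f₂ := fun _ => (1 : ℝ)) fun w hw => ?_).trans ?_
    · simp [Set.indicator_of_mem (show (z, w) ∈ bidisk from ⟨h z hz, h w hw⟩)]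
    · exact Real.circleAverage_const _ _ _
  rw [h1, Real.circleAverage_const]⟩

/-- A polynomial as an element of `H²(𝔻²)`. -/
def polyH2 (p : MvPolynomial (Fin 2) ℂ) : H2 := toeplitz p one

lemma polyH2_apply (p : MvPolynomial (Fin 2) ℂ) {x : ℂ × ℂ} (hx : x ∈ bidisk) :
    polyH2 p x = evalAt p x := by
  change evalAt p x * bidisk.indicator 1 x = _
  rw [Set.indicator_of_mem hx, Pi.one_apply, mul_one]

/-- The submodule `[p]` of `H²(𝔻²)` generated by `p`: the smallest closed subspace that contains
`p` and is invariant under multiplication by `z` and by `w`, i.e. the closure of `p ℂ[z, w]`. -/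
def principal (p : MvPolynomial (Fin 2) ℂ) : Submodule ℂ H2 :=
  (Submodule.span ℂ (Set.range fun g => polyH2 (g * p))).topologicalClosure

/-- The quotient module `[p]^⊥ = H²(𝔻²) ⊖ [p]`. -/
abbrev quotientModule (p : MvPolynomial (Fin 2) ℂ) : Submodule ℂ H2 := (principal p)ᗮ

/-- The compressed shift `S_z = P_N T_z|_N` on `N = [p]^⊥`. -/
def compressedShift (p : MvPolynomial (Fin 2) ℂ) :
    quotientModule p →L[ℂ] quotientModule p :=
  (quotientModule p).orthogonalProjectionOnto ∘L toeplitz (MvPolynomial.X 0) ∘L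
    (quotientModule p).subtypeL

/-- `p` has no nonconstant factor that depends only on the variable `z`. -/
def NoFactorInZ (p : MvPolynomial (Fin 2) ℂ) : Prop :=
  ∀ g : Polynomial ℂ,
    Polynomial.aeval (MvPolynomial.X 0 : MvPolynomial (Fin 2) ℂ) g ∣ p → g.natDegree = 0

/-- `p` has the divisor property: every `f ∈ H²(𝔻²)` such that `f / p` is (extends to) a
holomorphic function on the bidisk belongs to `[p]`. -/
def HasDivisorProperty (p : MvPolynomial (Fin 2) ℂ) : Prop :=
  ∀ f : H2, (∃ h : ℂ × ℂ → ℂ, DifferentiableOn ℂ h bidisk ∧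
    ∀ x ∈ bidisk, f x = evalAt p x * h x) → f ∈ principal p

end Hardy

/-! ### Reducing subspaces -/

section Operators

variable {H : Type*} [NormedAddCommGroup H] [InnerProductSpace ℂ H] [CompleteSpace H]

/-- `M` is a reducing subspace of `T`: it is closed and invariant under `T` and `T*`. -/
def IsReducingSubspace (T : H →L[ℂ] H) (M : Submodule ℂ H) : Prop :=
  IsClosed (M : Set H) ∧ (∀ x ∈ M, T x ∈ M) ∧ ∀ x ∈ M, ContinuousLinearMap.adjoint T x ∈ M

/-- `T` is reducible: it has a reducing subspace other than `{0}` and the whole space. -/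
def IsReducible (T : H →L[ℂ] H) : Prop :=
  ∃ M : Submodule ℂ H, IsReducingSubspace T M ∧ M ≠ ⊥ ∧ M ≠ ⊤

/-- The von Neumann algebra `V*(T) = {T, T*}'`. -/
noncomputable def commutantAlgebra (T : H →L[ℂ] H) : VonNeumannAlgebra H where
  toStarSubalgebra := StarSubalgebra.centralizer ℂ {T, ContinuousLinearMap.adjoint T}
  centralizer_centralizer' := by simp

end Operators

end BidiskHardy

namespace BidiskHardy

open Complex MeasureTheory Metric
open scoped InnerProductSpace

/-! ### Operators unitarily equivalent to a multiple of another operator -/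

section Multiplicity

open ContinuousLinearMap

variable {H K : Type*} [NormedAddCommGroup H] [InnerProductSpace ℂ H] [CompleteSpace H]
  [NormedAddCommGroup K] [InnerProductSpace ℂ K] [CompleteSpace K]

/-! Sorting the powers of `w` by their residue mod `n` writes every `f` in H²(𝔻²) uniquely as the
orthogonal sum `f(z, w) = ∑ wⁱ fᵢ(z, wⁿ)`, `0 ≤ i < n`. The maps `Vᵢ : f ↦ wⁱ f(z, wⁿ)` are
therefore isometries with pairwise orthogonal ranges that fill the space, and `Vᵢ*` reads off the
component `fᵢ`. Multiplication by `z` does not touch the exponent of `w`, so both `Vᵢ` and `Vᵢ*`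
commute with it.

For `p = q(z, wⁿ)` this decomposition respects the submodules: `Vᵢ` maps `[q]` into `[p]` and `Vᵢ*`
maps `[p]` into `[q]` (`insertSlice_mem_principal`, `slice_mem_principal`). By duality the same
holds for the orthogonal complements, so the `Vᵢ` restrict to isometries `uᵢ` from `[q]^⊥` to
`[p]^⊥`, and both `uᵢ` and `uᵢ*` intertwine the two compressed shifts.

Hence the `n²` operators `uᵢ uⱼ*` lie in the commutant of `S_z` and its adjoint. They are matrix
units, nonzero because a zero of `p` in the bidisk produces one of `q`, which makes `[q]^⊥`
nontrivial. Matrix units are linearly independent, and the kernel of a diagonal one is a proper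
nonzero reducing subspace; this is `isReducible_and_le_rank_of_multiple`. -/

lemma mem_commutantAlgebra {T A : H →L[ℂ] H} (h : T ∘L A = A ∘L T)
    (h' : adjoint T ∘L A = A ∘L adjoint T) :
    A ∈ (commutantAlgebra T).toStarSubalgebra := by
  change A ∈ StarSubalgebra.centralizer ℂ {T, adjoint T}
  rw [StarSubalgebra.mem_centralizer_iff]
  rintro g (rfl | rfl)
  · exact ⟨h, h'⟩
  · refine ⟨h', ?_⟩
    rw [star_eq_adjoint, adjoint_adjoint]
    exact h

lemma isReducingSubspace_ker {T A : H →L[ℂ] H} (h : T ∘L A = A ∘L T)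
    (h' : adjoint T ∘L A = A ∘L adjoint T) : IsReducingSubspace T A.ker := by
  refine ⟨A.isClosed_ker, fun x hx => ?_, fun x hx => ?_⟩
  · have hx : A x = 0 := hx
    change A (T x) = 0
    rw [← comp_apply, ← h, comp_apply, hx, map_zero]
  · have hx : A x = 0 := hx
    change A (adjoint T x) = 0
    rw [← comp_apply, ← h', comp_apply, hx, map_zero]

/-- If the `u i` and their adjoints intertwine `T` and `S`, then the operators `u i ∘ (u j)*`
commute with `T`. -/
lemma comp_matrixUnit {ι : Type*} {T : H →L[ℂ] H} {S : K →L[ℂ] K} {u : ι → K →L[ℂ] H}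
    (h : ∀ i, T ∘L u i = u i ∘L S) (h' : ∀ i, adjoint (u i) ∘L T = S ∘L adjoint (u i)) (i j : ι) :
    T ∘L (u i ∘L adjoint (u j)) = (u i ∘L adjoint (u j)) ∘L T := by
  rw [← comp_assoc, h, comp_assoc, comp_assoc, h']

/-- Taking adjoints in `comp_matrixUnit` suffices, because the family is closed under adjoints: `(uⱼ
uᵢ*)* = uᵢ uⱼ*`. This is why the indices are swapped in the proof. -/
lemma adjoint_comp_matrixUnit {ι : Type*} {T : H →L[ℂ] H} {S : K →L[ℂ] K} {u : ι → K →L[ℂ] H}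
    (h : ∀ i, T ∘L u i = u i ∘L S) (h' : ∀ i, adjoint (u i) ∘L T = S ∘L adjoint (u i)) (i j : ι) :
    adjoint T ∘L (u i ∘L adjoint (u j)) = (u i ∘L adjoint (u j)) ∘L adjoint T := by
  have := congrArg adjoint (comp_matrixUnit h h' j i)
  simpa only [adjoint_comp, adjoint_adjoint] using this.symm

/-- If isometries with pairwise orthogonal ranges and their adjoints intertwine `T` and `S`, then
`T` is reducible and its commutant contains `n ^ 2` linearly independent matrix units. -/
theorem isReducible_and_le_rank_of_multiple [Nontrivial K] {n : ℕ} (hn : 2 ≤ n)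
    {T : H →L[ℂ] H} {S : K →L[ℂ] K} {u : Fin n → K →L[ℂ] H}
    (hu : ∀ i j x, adjoint (u i) (u j x) = if i = j then x else 0)
    (h : ∀ i, T ∘L u i = u i ∘L S) (h' : ∀ i, adjoint (u i) ∘L T = S ∘L adjoint (u i)) :
    IsReducible T ∧
      ((n ^ 2 : ℕ) : Cardinal) ≤ Module.rank ℂ (commutantAlgebra T).toStarSubalgebra := by
  obtain ⟨x, hx⟩ := exists_ne (0 : K)
  have hux : ∀ i, u i x ≠ 0 := fun i h0 => hx <| by
    simpa [h0] using (hu i i x).symm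
  constructor
  -- The kernel of `u₀ u₀*` is the orthogonal complement of the range of `u₀`. It contains `u₁ x`
  -- but not `u₀ x`; the index 1 exists since `n ≥ 2`.
  · refine ⟨(u ⟨0, by omega⟩ ∘L adjoint (u ⟨0, by omega⟩)).ker,
      isReducingSubspace_ker (comp_matrixUnit h h' _ _) (adjoint_comp_matrixUnit h h' _ _), ?_, ?_⟩
    · rw [Submodule.ne_bot_iff]
      exact ⟨u ⟨1, by omega⟩ x, by simp [hu], hux _⟩
    · intro htop
      have hmem : u ⟨0, by omega⟩ x ∈ (u ⟨0, by omega⟩ ∘L adjoint (u ⟨0, by omega⟩)).ker :=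
        htop ▸ Submodule.mem_top
      exact hux ⟨0, by omega⟩ (by simpa [hu] using hmem)
  · let E : Fin n × Fin n → (commutantAlgebra T).toStarSubalgebra := fun m =>
      ⟨u m.1 ∘L adjoint (u m.2), mem_commutantAlgebra (comp_matrixUnit h h' _ _)
        (adjoint_comp_matrixUnit h h' _ _)⟩
    have hE : LinearIndependent ℂ E := by
      rw [Fintype.linearIndependent_iff]
      rintro c hc ⟨k, l⟩
      have h1 : ∑ m, c m • (u m.1 ∘L adjoint (u m.2)) = 0 := by
        simpa [E] using congrArg Subtype.val hc
      -- Compressing a combination of matrix units by `uₖ*` on the left and `uₗ` on the right leaves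
      -- only the `(k, l)` coefficient, times `x ≠ 0`.
      have h2 := congrArg (fun A : H →L[ℂ] H => adjoint (u k) (A (u l x))) h1
      simp only [sum_apply, smul_apply, comp_apply, hu, zero_apply, map_zero, map_sum, map_smul]
        at h2
      rw [Finset.sum_eq_single (k, l)] at h2
      · simpa [hu, hx] using h2
      · rintro ⟨i, j⟩ - hij
        by_cases hj : j = l
        · have hi : k ≠ i := fun hi => hij (by rw [hi, hj])
          simp [hj, hi]
        · simp [hj]
      · simp
    simpa [sq] using hE.cardinal_lift_le_rank

end Multiplicity

/-! ### Restriction of square-summable sequences along an injection -/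

noncomputable section

section Restriction

variable {ι : Type*} {φ : ι → ι}

lemma memℓp_comp (hφ : Function.Injective φ) (a : lp (fun _ : ι => ℂ) 2) :
    Memℓp (fun i => a (φ i)) 2 := by
  have := lp.memℓp a
  rw [memℓp_gen_iff (by simp)] at this ⊢
  exact this.comp_injective hφ

/-- The contraction `a ↦ a ∘ φ` of `ℓ²`, for `φ` injective. -/
def lpRestrict (hφ : Function.Injective φ) : lp (fun _ : ι => ℂ) 2 →L[ℂ] lp (fun _ : ι => ℂ) 2 :=
  LinearMap.mkContinuous
    { toFun := fun a => ⟨fun i => a (φ i), memℓp_comp hφ a⟩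
      map_add' := fun _ _ => rfl
      map_smul' := fun _ _ => rfl } 1 (fun a => by
    rw [one_mul]
    refine lp.norm_le_of_tsum_le (by simp) (norm_nonneg _) ?_
    rw [lp.norm_rpow_eq_tsum (by simp) a]
    have h := (memℓp_gen_iff (by simp)).1 (lp.memℓp a)
    exact tsum_comp_le_tsum_of_inj h (fun i => by positivity) hφ)

lemma lpRestrict_apply (hφ : Function.Injective φ) (a : lp (fun _ : ι => ℂ) 2) (i : ι) :
    lpRestrict hφ a i = a (φ i) := rfl

/-- Coordinates of the adjoint are found by testing against the standard basis. Restriction along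
`φ` sends the basis vector at `φ i` to the one at `i` and kills those off the range, so its adjoint
is extension by zero, as the next two lemmas record. -/
lemma adjoint_lpRestrict_eq_inner [DecidableEq ι] (hφ : Function.Injective φ)
    (a : lp (fun _ : ι => ℂ) 2) (i : ι) :
    (lpRestrict hφ).adjoint a i = ⟪lpRestrict hφ (lp.single 2 i 1), a⟫_ℂ := by
  rw [← ContinuousLinearMap.adjoint_inner_right, lp.inner_single_left]
  simp

lemma adjoint_lpRestrict_apply (hφ : Function.Injective φ) (a : lp (fun _ : ι => ℂ) 2) (i : ι) :
    (lpRestrict hφ).adjoint a (φ i) = a i := by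
  classical
  have : lpRestrict hφ (lp.single 2 (φ i) 1) = lp.single 2 i 1 := by
    ext k
    simp [lpRestrict_apply, Pi.single_apply, hφ.eq_iff]
  rw [adjoint_lpRestrict_eq_inner, this, lp.inner_single_left]
  simp

lemma adjoint_lpRestrict_apply_of_notMem (hφ : Function.Injective φ) (a : lp (fun _ : ι => ℂ) 2)
    {i : ι} (hi : i ∉ Set.range φ) : (lpRestrict hφ).adjoint a i = 0 := by
  classical
  have : lpRestrict hφ (lp.single 2 i 1) = 0 := by
    ext k
    have : φ k ≠ i := fun h => hi ⟨k, h⟩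
    simp [lpRestrict_apply, this]
  rw [adjoint_lpRestrict_eq_inner, this, inner_zero_left]

end Restriction

/-! ### The isometries `f(z, w) ↦ wⁱ f(z, wⁿ)` -/

section Slices

variable {n : ℕ}

/-- The exponents of `zᵃ wⁿᵇ⁺ⁱ`. -/
def spread (i : Fin n) (m : ℕ × ℕ) : ℕ × ℕ := (m.1, n * m.2 + i)

/-- Euclidean division of the second exponent by `n`: the ranges of the maps `spread i` are the
residue classes, so they partition `ℕ × ℕ`. Disjointness gives the orthogonality of the slices,
covering gives their completeness. -/
lemma spread_eq_iff {i : Fin n} {m k : ℕ × ℕ} :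
    spread i m = k ↔ m = (k.1, k.2 / n) ∧ k.2 % n = i := by
  obtain ⟨a, b⟩ := m
  obtain ⟨c, d⟩ := k
  have hn : 0 < n := i.pos
  simp only [spread, Prod.mk.injEq]
  constructor
  · rintro ⟨rfl, rfl⟩
    simp [Nat.mul_add_div hn, Nat.mod_eq_of_lt i.2]
  · rintro ⟨⟨rfl, rfl⟩, h⟩
    exact ⟨rfl, by rw [← h, Nat.div_add_mod]⟩

lemma spread_injective (i : Fin n) : Function.Injective (spread i) := fun m k h => by
  rw [(spread_eq_iff.1 h).1, ← (spread_eq_iff.1 (rfl : spread i k = spread i k)).1]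

/-- The isometry `f(z, w) ↦ wⁱ f(z, wⁿ)` of `H²(𝔻²)`. -/
def insertSlice (i : Fin n) : H2 →L[ℂ] H2 :=
  coeffEquiv.symm.toContinuousLinearEquiv.toContinuousLinearMap ∘L
    (lpRestrict (spread_injective i)).adjoint ∘L
      coeffEquiv.toContinuousLinearEquiv.toContinuousLinearMap

/-- The operator that takes `∑ i, wⁱ fᵢ(z, wⁿ)` to `fᵢ(z, w)`. -/
def slice (i : Fin n) : H2 →L[ℂ] H2 :=
  coeffEquiv.symm.toContinuousLinearEquiv.toContinuousLinearMap ∘L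
    lpRestrict (spread_injective i) ∘L
      coeffEquiv.toContinuousLinearEquiv.toContinuousLinearMap

lemma toCoeff_insertSlice (i : Fin n) (f : H2) :
    toCoeff (insertSlice i f) = (lpRestrict (spread_injective i)).adjoint (toCoeff f) :=
  coeffEquiv.apply_symm_apply _

lemma toCoeff_slice (i : Fin n) (f : H2) (m : ℕ × ℕ) :
    toCoeff (slice i f) m = toCoeff f (spread i m) := by
  have : toCoeff (slice i f) = lpRestrict (spread_injective i) (toCoeff f) :=
    coeffEquiv.apply_symm_apply _
  rw [this, lpRestrict_apply]

/-- The Taylor coefficient map is unitary, so the adjoint relation on `ℓ²` carries over to `slice`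
and `insertSlice`. -/
lemma inner_slice_left (i : Fin n) (f g : H2) : ⟪slice i f, g⟫_ℂ = ⟪f, insertSlice i g⟫_ℂ := by
  rw [← coeffEquiv.inner_map_map, ← coeffEquiv.inner_map_map f]
  simp [slice, insertSlice, ContinuousLinearMap.adjoint_inner_right]

lemma toCoeff_ext {f g : H2} (h : ∀ m, toCoeff f m = toCoeff g m) : f = g :=
  toCoeff_bijective.1 (Subtype.ext (funext h))

lemma slice_insertSlice (i j : Fin n) (f : H2) :
    slice i (insertSlice j f) = if i = j then f else 0 := by
  refine toCoeff_ext fun m => ?_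
  rw [toCoeff_slice, toCoeff_insertSlice]
  split_ifs with h
  · rw [h, adjoint_lpRestrict_apply]
  · rw [adjoint_lpRestrict_apply_of_notMem, map_zero]
    · rfl
    · rintro ⟨k, hk⟩
      have h1 := (spread_eq_iff.1 hk).2
      have h2 := (spread_eq_iff.1 (rfl : spread i m = spread i m)).2
      exact h (Fin.ext (h2.symm.trans h1))

lemma sum_insertSlice_slice (hn : 0 < n) (f : H2) :
    ∑ i : Fin n, insertSlice i (slice i f) = f := by
  refine toCoeff_ext fun m => ?_
  have hm : ∀ i : Fin n, toCoeff (insertSlice i (slice i f)) m =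
      if i = ⟨m.2 % n, Nat.mod_lt _ hn⟩ then toCoeff f m else 0 := by
    intro i
    rw [toCoeff_insertSlice]
    split_ifs with h
    · have hs : spread i (m.1, m.2 / n) = m := spread_eq_iff.2 ⟨rfl, by rw [h]⟩
      conv_lhs => rw [← hs]
      rw [adjoint_lpRestrict_apply, toCoeff_slice, hs]
    · refine adjoint_lpRestrict_apply_of_notMem _ _ ?_
      rintro ⟨k, hk⟩
      exact h (Fin.ext (spread_eq_iff.1 hk).2.symm)
  -- Evaluation at a coordinate is linear, so it passes through the finite sum; exactly one residue
  -- class contains `m.2`.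
  have hev := map_sum (lp.evalCLM ℂ (fun _ : ℕ × ℕ => ℂ) 2 m)
    (fun i : Fin n => toCoeff (insertSlice i (slice i f))) Finset.univ
  rw [map_sum]
  refine hev.trans ?_
  refine (Finset.sum_congr rfl fun i _ => hm i).trans ?_
  simp

lemma insertSlice_apply (i : Fin n) (f : H2) {z w : ℂ} (h : (z, w) ∈ bidisk) :
    insertSlice i f (z, w) = w ^ (i : ℕ) * f (z, w ^ n) := by
  have hw : ‖w‖ < 1 := by simpa using h.2
  have h' : (z, w ^ n) ∈ bidisk := ⟨h.1, by
    simpa using pow_lt_one₀ (norm_nonneg w) hw i.pos.ne'⟩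
  refine ((insertSlice i f).hasSum h).unique ?_
  -- Coefficients vanish off the range of `spread i`, so the power series can be reindexed by the
  -- exponents of `f`.
  rw [← (spread_injective i).hasSum_iff fun m hm => by
    rw [toCoeff_insertSlice, adjoint_lpRestrict_apply_of_notMem _ _ hm, zero_mul, zero_mul]]
  refine ((f.hasSum h').mul_left (w ^ (i : ℕ))).congr_fun fun m => ?_
  rw [Function.comp, toCoeff_insertSlice, adjoint_lpRestrict_apply]
  simp only [spread]
  ring

lemma toeplitz_apply (p : MvPolynomial (Fin 2) ℂ) (f : H2) (x : ℂ × ℂ) :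
    toeplitz p f x = evalAt p x * f x := rfl

lemma insertSlice_shift (i : Fin n) (f : H2) :
    insertSlice i (toeplitz (MvPolynomial.X 0) f) =
      toeplitz (MvPolynomial.X 0) (insertSlice i f) := by
  refine H2.ext fun x hx => ?_
  rw [toeplitz_apply, insertSlice_apply i _ hx, insertSlice_apply i _ hx, toeplitz_apply]
  simp [evalAt]
  ring

/-- The adjoint of `insertSlice_shift` would only concern the adjoint of multiplication by `z`.
Commutation with multiplication by `z` itself uses completeness: decompose `f` into slices, move `z`
inside each, and read off the `i`-th one. -/
lemma slice_shift (i : Fin n) (f : H2) :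
    slice i (toeplitz (MvPolynomial.X 0) f) = toeplitz (MvPolynomial.X 0) (slice i f) := by
  conv_lhs => rw [← sum_insertSlice_slice i.pos f]
  simp only [map_sum, ← insertSlice_shift, slice_insertSlice]
  simp

end Slices

/-! ### Slices of principal submodules -/

section Principal

open MvPolynomial

variable {n : ℕ} {p q : MvPolynomial (Fin 2) ℂ}

/-- The substitution `g(z, w) ↦ g(z, wⁿ)`. -/
def powSubst (n : ℕ) : MvPolynomial (Fin 2) ℂ →ₐ[ℂ] MvPolynomial (Fin 2) ℂ :=
  aeval ![X 0, X 1 ^ n]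

lemma evalAt_powSubst (g : MvPolynomial (Fin 2) ℂ) (z w : ℂ) :
    evalAt (powSubst n g) (z, w) = evalAt g (z, w ^ n) := by
  simp only [evalAt, powSubst, ← coe_aeval_eq_eval, RingHom.coe_coe]
  rw [← AlgHom.comp_apply, comp_aeval]
  congr 2
  ext i
  fin_cases i <;> simp

lemma insertSlice_polyH2 (i : Fin n) (g : MvPolynomial (Fin 2) ℂ) :
    insertSlice i (polyH2 g) = polyH2 (X 1 ^ (i : ℕ) * powSubst n g) := by
  refine H2.ext fun x hx => ?_
  have hw : ‖x.2‖ < 1 := by simpa using hx.2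
  have h' : (x.1, x.2 ^ n) ∈ bidisk := ⟨hx.1, by
    simpa using pow_lt_one₀ (norm_nonneg x.2) hw i.pos.ne'⟩
  rw [insertSlice_apply i _ hx, polyH2_apply _ hx, polyH2_apply _ h', ← evalAt_powSubst]
  simp [evalAt]

lemma polyH2_mem_principal (g : MvPolynomial (Fin 2) ℂ) : polyH2 (g * p) ∈ principal p :=
  Submodule.le_topologicalClosure _ (Submodule.subset_span ⟨g, rfl⟩)

/-- The preimage of a closed subspace under a bounded operator is closed, so membership need only be
checked on polynomial multiples of `p`. -/
lemma principal_induction {M : Submodule ℂ H2} (hM : IsClosed (M : Set H2)) (A : H2 →L[ℂ] H2)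
    (h : ∀ g, A (polyH2 (g * p)) ∈ M) {f : H2} (hf : f ∈ principal p) : A f ∈ M := by
  have : principal p ≤ M.comap A.toLinearMap :=
    Submodule.topologicalClosure_minimal _ (Submodule.span_le.2 (by rintro _ ⟨g, rfl⟩; exact h g))
      (hM.preimage A.continuous)
  exact this hf

lemma isClosed_principal : IsClosed (principal p : Set H2) :=
  Submodule.isClosed_topologicalClosure _

lemma insertSlice_mem_principal (i : Fin n) {f : H2} (hf : f ∈ principal q) :
    insertSlice i f ∈ principal (powSubst n q) := by
  refine principal_induction isClosed_principal _ (fun g => ?_) hf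
  rw [insertSlice_polyH2, map_mul, ← mul_assoc]
  exact polyH2_mem_principal _

lemma monomial_eq_powSubst (n : ℕ) (s : Fin 2 →₀ ℕ) (c : ℂ) :
    monomial s c = X 1 ^ (s 1 % n) * powSubst n (C c * X 0 ^ s 0 * X 1 ^ (s 1 / n)) := by
  rw [monomial_eq, Finsupp.prod_fintype _ _ (by simp), Fin.prod_univ_two]
  simp only [powSubst, map_mul, map_pow, aeval_X, aeval_C, algebraMap_eq, Matrix.cons_val_zero,
    Matrix.cons_val_one, ← pow_mul]
  conv_lhs => rw [← Nat.mod_add_div (s 1) n, pow_add]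
  ring

lemma polyH2_add (g h : MvPolynomial (Fin 2) ℂ) : polyH2 (g + h) = polyH2 g + polyH2 h := by
  refine H2.ext fun x hx => ?_
  change _ = polyH2 g x + polyH2 h x
  rw [polyH2_apply _ hx, polyH2_apply _ hx, polyH2_apply _ hx]
  simp [evalAt]

/-- By linearity, take a monomial multiplier and write it as `wʳ h(z, wⁿ)` with `r < n`. Its product
with `q(z, wⁿ)` is `wʳ (h q)(z, wⁿ)`, which has the single nonzero slice `h q`, or none, and so
stays in `[q]`. -/
lemma slice_mem_principal (i : Fin n) {f : H2} (hf : f ∈ principal (powSubst n q)) :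
    slice i f ∈ principal q := by
  refine principal_induction isClosed_principal _ (fun g => ?_) hf
  induction g using MvPolynomial.induction_on' with
  | monomial s c =>
    rw [monomial_eq_powSubst n, mul_assoc, ← map_mul,
      ← insertSlice_polyH2 ⟨s 1 % n, Nat.mod_lt _ i.pos⟩, slice_insertSlice]
    split_ifs
    · exact polyH2_mem_principal _
    · exact zero_mem _
  | add g h hg hh =>
    rw [add_mul, polyH2_add, map_add]
    exact add_mem hg hh

lemma insertSlice_mem_quotientModule (i : Fin n) {f : H2} (hf : f ∈ quotientModule q) :
    insertSlice i f ∈ quotientModule (powSubst n q) := by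
  rw [Submodule.mem_orthogonal]
  intro g hg
  rw [← inner_slice_left]
  exact hf _ (slice_mem_principal i hg)

lemma slice_mem_quotientModule (i : Fin n) {f : H2} (hf : f ∈ quotientModule (powSubst n q)) :
    slice i f ∈ quotientModule q := by
  rw [Submodule.mem_orthogonal']
  intro g hg
  rw [inner_slice_left]
  exact Submodule.inner_left_of_mem_orthogonal (insertSlice_mem_principal i hg) hf

/-- The isometry `f(z, w) ↦ wⁱ f(z, wⁿ)` between the quotient modules of `q(z, w)` and
`q(z, wⁿ)`. -/
def insertSliceQuotient (q : MvPolynomial (Fin 2) ℂ) (i : Fin n) :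
    quotientModule q →L[ℂ] quotientModule (powSubst n q) :=
  (insertSlice i ∘L (quotientModule q).subtypeL).codRestrict _
    fun f => insertSlice_mem_quotientModule i f.2

lemma adjoint_insertSliceQuotient_apply (i : Fin n) (f : quotientModule (powSubst n q)) :
    (insertSliceQuotient q i).adjoint f = ⟨slice i f, slice_mem_quotientModule i f.2⟩ := by
  refine ext_inner_right ℂ fun g => ?_
  rw [ContinuousLinearMap.adjoint_inner_left]
  exact (inner_slice_left i f g).symm

/-- Tested against a vector of the quotient module, the projection disappears. The intertwining
relations are therefore proved weakly, from those for multiplication by `z` on the whole space. -/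
lemma inner_compressedShift (f g : quotientModule p) :
    ⟪g, compressedShift p f⟫_ℂ = ⟪(g : H2), toeplitz (X 0) f⟫_ℂ :=
  Submodule.inner_orthogonalProjectionOnto_eq_of_mem_left _ _

lemma compressedShift_comp_insertSliceQuotient (i : Fin n) :
    compressedShift (powSubst n q) ∘L insertSliceQuotient q i =
      insertSliceQuotient q i ∘L compressedShift q := by
  ext1 f
  refine ext_inner_left ℂ fun g => ?_
  rw [ContinuousLinearMap.comp_apply, ContinuousLinearMap.comp_apply, inner_compressedShift,
    ← ContinuousLinearMap.adjoint_inner_left (insertSliceQuotient q i),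
    adjoint_insertSliceQuotient_apply, inner_compressedShift, inner_slice_left, insertSlice_shift]
  rfl

lemma adjoint_insertSliceQuotient_comp_compressedShift (i : Fin n) :
    (insertSliceQuotient q i).adjoint ∘L compressedShift (powSubst n q) =
      compressedShift q ∘L (insertSliceQuotient q i).adjoint := by
  ext1 f
  refine ext_inner_left ℂ fun g => ?_
  rw [ContinuousLinearMap.comp_apply, ContinuousLinearMap.comp_apply, inner_compressedShift,
    ContinuousLinearMap.adjoint_inner_right, adjoint_insertSliceQuotient_apply,
    -- Here the slice sits in the second argument of the inner product, so the adjoint relation is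
    -- applied after conjugation.
    inner_compressedShift, ← slice_shift, ← inner_conj_symm (g : H2), inner_slice_left,
    inner_conj_symm]
  rfl

end Principal

/-! ### Point evaluations -/

/-- Each Taylor coefficient is at most the norm, and the monomials are absolutely summable at a
point of the bidisk. This crude bound is enough for continuity of evaluation. -/
lemma H2.norm_apply_le (f : H2) {x : ℂ × ℂ} (hx : x ∈ bidisk) :
    ‖f x‖ ≤ (∑' m : ℕ × ℕ, ‖x.1 ^ m.1 * x.2 ^ m.2‖) * ‖f‖ := by
  have hs : Summable fun m : ℕ × ℕ => ‖x.1 ^ m.1 * x.2 ^ m.2‖ := by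
    simpa using summable_monomials (a := fun _ => 1) (C := 1) (by simp) hx
  rw [mul_comm, ← (f.hasSum hx).tsum_eq]
  refine tsum_of_norm_bounded (hs.hasSum.mul_left _) fun m => ?_
  rw [mul_assoc, norm_mul, H2.norm_def, hardyNorm_eq]
  gcongr
  exact lp.norm_apply_le_norm (by simp) (toCoeff f) m

/-- Evaluation at a point of the bidisk, as a bounded functional on `H²(𝔻²)`. -/
def evalCLM {x : ℂ × ℂ} (hx : x ∈ bidisk) : H2 →L[ℂ] ℂ :=
  LinearMap.mkContinuous
    { toFun := fun f => f x
      map_add' := fun _ _ => rfl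
      map_smul' := fun _ _ => rfl } _ fun f => f.norm_apply_le hx

/-- Evaluation at the zero `x` is continuous and kills every multiple of `q`, hence all of `[q]`,
but not the constant 1. -/
lemma principal_ne_top {q : MvPolynomial (Fin 2) ℂ} {x : ℂ × ℂ} (hx : x ∈ bidisk)
    (hq : evalAt q x = 0) : principal q ≠ ⊤ := by
  intro htop
  have hle : principal q ≤ (evalCLM hx).ker := by
    refine Submodule.topologicalClosure_minimal _ (Submodule.span_le.2 ?_)
      (evalCLM hx).isClosed_ker
    rintro _ ⟨g, rfl⟩
    change polyH2 (g * q) x = 0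
    rw [polyH2_apply _ hx]
    simp [evalAt] at hq ⊢
    exact Or.inr hq
  have h1 : polyH2 1 x = 0 := hle (htop ▸ Submodule.mem_top : polyH2 1 ∈ principal q)
  rw [polyH2_apply _ hx] at h1
  simp [evalAt] at h1

lemma nontrivial_quotientModule {q : MvPolynomial (Fin 2) ℂ} {x : ℂ × ℂ} (hx : x ∈ bidisk)
    (hq : evalAt q x = 0) : Nontrivial (quotientModule q) := by
  have : CompleteSpace (principal q) := isClosed_principal.completeSpace_coe
  rw [Submodule.nontrivial_iff_ne_bot, Ne, Submodule.orthogonal_eq_bot_iff]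
  exact principal_ne_top hx hq

end

end BidiskHardy

/-! ### Reducibility and the commutant for `q(z, wⁿ)` -/

theorem mainTheorem12 (p q : MvPolynomial (Fin 2) ℂ) (n : ℕ) (hn : 2 ≤ n)
    (hz : BidiskHardy.NoFactorInZ p) (hdiv : BidiskHardy.HasDivisorProperty p)
    (hzero : ∃ x ∈ BidiskHardy.bidisk, BidiskHardy.evalAt p x = 0)
    (hpq : p = MvPolynomial.aeval ![MvPolynomial.X 0, MvPolynomial.X 1 ^ n] q) :
    BidiskHardy.IsReducible (BidiskHardy.compressedShift p) ∧
      ((n ^ 2 : ℕ) : Cardinal) ≤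
        Module.rank ℂ (BidiskHardy.commutantAlgebra (BidiskHardy.compressedShift p)).toStarSubalgebra := by
  change p = BidiskHardy.powSubst n q at hpq
  subst hpq
  obtain ⟨⟨z, w⟩, hx, h0⟩ := hzero
  -- A zero `(z, w)` of `p` gives the zero `(z, wⁿ)` of `q`, again in the bidisk.
  rw [BidiskHardy.evalAt_powSubst] at h0
  have hw : ‖w‖ < 1 := by simpa using hx.2
  have hx' : (z, w ^ n) ∈ BidiskHardy.bidisk :=
    ⟨hx.1, by simpa using pow_lt_one₀ (norm_nonneg w) hw (by omega)⟩
  have := BidiskHardy.nontrivial_quotientModule hx' h0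
  refine BidiskHardy.isReducible_and_le_rank_of_multiple hn
    (u := BidiskHardy.insertSliceQuotient q) (fun i j f => ?_)
    BidiskHardy.compressedShift_comp_insertSliceQuotient
    BidiskHardy.adjoint_insertSliceQuotient_comp_compressedShift
  rw [BidiskHardy.adjoint_insertSliceQuotient_apply]
  refine Subtype.ext ((BidiskHardy.slice_insertSlice i j (f : BidiskHardy.H2)).trans ?_)
  split_ifs <;> rfl
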